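/- Let $(M,g)$ be either the plane $\mathbb{R}^2$ with a smooth Riemannian metric $g$ invariant under the translations by $\mathbb{Z}^2$, or the cylinder $S^1\times\mathbb{R}$ with a smooth Riemannian metric $g$ invariant under the translations $(z,t)\mapsto(z,t+k)$, $k\in\mathbb{Z}$. Let $K$ denote the Gaussian curvature of $g$, $\mu$ its Riemannian measure and $\Delta$ its non-negative Laplacian. For $a\in\mathbb{R}$ write $\Delta+aK\ge 0$ if $$\int_M\big(|df|_g^2+aKf^2\big)\,d\mu\ \ge\ 0$$ for every $C^1$ function $f:M\to\mathbb{R}$ with compact support, and let $$I(M,g;K)=\{a\in\mathbb{R} : \Delta+aK\ge 0\}.$$ Then $I(M,g;K)=\{0\}$ or $I(M,g;K)=\mathbb{R}$. Furthermore, $I(M,g;K)=\mathbb{R}$ if and only if $K\equiv 0$. -/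

import Mathlib

open scoped Manifold ContDiff

noncomputable section

namespace PeriodicSurface

/-! ### Riemannian geometry in local coordinates `(x¹, x²) ∈ ℝ²` -/

/-- The standard basis `∂₁ = (1, 0)`, `∂₂ = (0, 1)` of `ℝ²`. -/
def e : Fin 2 → ℝ × ℝ := ![(1, 0), (0, 1)]

/-- The partial derivative `∂ᵢ u` at `x`. -/
def partialDeriv (i : Fin 2) (u : ℝ × ℝ → ℝ) (x : ℝ × ℝ) : ℝ := fderiv ℝ u x (e i)

/-- Christoffel symbols of the second kind of the metric `∑ Gᵢⱼ dxⁱ dxʲ`: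
`Γᵏᵢⱼ = ½ ∑ₗ Gᵏˡ (∂ᵢ Gⱼₗ + ∂ⱼ Gᵢₗ - ∂ₗ Gᵢⱼ)`, where `(Gᵏˡ)` is the inverse matrix of `(Gₖₗ)`. -/
def christoffel (G : ℝ × ℝ → Matrix (Fin 2) (Fin 2) ℝ) (k i j : Fin 2) (x : ℝ × ℝ) : ℝ :=
  (1 / 2 : ℝ) * ∑ l, (G x)⁻¹ k l *
    (partialDeriv i (fun y => G y j l) x + partialDeriv j (fun y => G y i l) x
      - partialDeriv l (fun y => G y i j) x)

/-- Components of the curvature tensor `R(X, Y)Z = ∇_X ∇_Y Z - ∇_Y ∇_X Z - ∇_[X,Y] Z` of the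
Levi-Civita connection: `R(∂ᵢ, ∂ⱼ)∂ₖ = ∑ₗ (riemann G l k i j) ∂ₗ`. -/
def riemann (G : ℝ × ℝ → Matrix (Fin 2) (Fin 2) ℝ) (l k i j : Fin 2) (x : ℝ × ℝ) : ℝ :=
  partialDeriv i (christoffel G l j k) x - partialDeriv j (christoffel G l i k) x
    + ∑ m, (christoffel G l i m x * christoffel G m j k x
        - christoffel G l j m x * christoffel G m i k x)

/-- Gaussian curvature in coordinates: `⟨R(∂₁, ∂₂)∂₂, ∂₁⟩ / (G₁₁ G₂₂ - G₁₂²)`. -/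
def coordGaussCurvature (G : ℝ × ℝ → Matrix (Fin 2) (Fin 2) ℝ) (x : ℝ × ℝ) : ℝ :=
  (∑ l, riemann G l 1 0 1 x * G x l 0) / (G x).det

/-! ### Riemannian surfaces with a covering by the coordinate plane

Here `M` is a smooth surface, `p : ℝ² → M` is a surjective local diffeomorphism and `s : M → ℝ²`
is a right inverse of `p`.  Around every point `m` a local inverse of `p` defined near `m` and
sending `m` to `s m` is a chart of `M`, and it is in this chart that tensors are evaluated. -/

section Surface

variable {E : Type*} [NormedAddCommGroup E] [NormedSpace ℝ E]
  {H : Type*} [TopologicalSpace H] {I : ModelWithCorners ℝ E H}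
  {M : Type*} [TopologicalSpace M] [ChartedSpace H M] [IsManifold I 1 M]

variable (I M) in
/-- Smooth Riemannian metrics on the manifold `M`. -/
abbrev SmoothMetric : Type _ :=
  Bundle.ContMDiffRiemannianMetric I ∞ E (fun m : M => TangentSpace I m)

/-- The map `τ` preserves the metric: `τ^* g = g`. -/
def Preserves (g : SmoothMetric I M) (τ : M → M) : Prop :=
  ∀ (m : M) (v w : TangentSpace I m),
    g.inner (τ m) (mfderiv I I τ m v) (mfderiv I I τ m w) = g.inner m v w

/-- The coefficients `gᵢⱼ = g(∂ᵢ p, ∂ⱼ p)` of the metric in the coordinates `p`. -/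
def gram (g : SmoothMetric I M) (p : ℝ × ℝ → M) (x : ℝ × ℝ) : Matrix (Fin 2) (Fin 2) ℝ :=
  Matrix.of fun i j =>
    g.inner (p x) (mfderiv 𝓘(ℝ, ℝ × ℝ) I p x (e i)) (mfderiv 𝓘(ℝ, ℝ × ℝ) I p x (e j))

/-- The Gaussian curvature of `(M, g)` at `m`. -/
def gaussCurvature (g : SmoothMetric I M) (p : ℝ × ℝ → M) (s : M → ℝ × ℝ) (m : M) : ℝ :=
  coordGaussCurvature (gram g p) (s m)

/-- The squared norm `|df|² = ∑ gⁱʲ ∂ᵢf ∂ⱼf` of the differential of `f` at `m`. -/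
def normSqDiff (g : SmoothMetric I M) (p : ℝ × ℝ → M) (s : M → ℝ × ℝ) (f : M → ℝ) (m : M) : ℝ :=
  ∑ i, ∑ j, (gram g p (s m))⁻¹ i j
    * partialDeriv i (fun x => f (p x)) (s m) * partialDeriv j (fun x => f (p x)) (s m)

/-- The Riemannian measure of `(M, g)`: the image under `p` of `√(det g) dx¹ dx²` on the range
of `s`, a set of coordinates which meets every fibre of `p` in exactly one point. -/
def riemMeasure [MeasurableSpace M] (g : SmoothMetric I M) (p : ℝ × ℝ → M) (s : M → ℝ × ℝ) :
    MeasureTheory.Measure M :=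
  ((MeasureTheory.volume.restrict (Set.range s)).withDensity
    (fun x => ENNReal.ofReal (√ (gram g p x).det))).map p

/-- `Δ + V ≥ 0` in the sense of quadratic forms, on compactly supported `C¹` functions. -/
def IsNonnegative [MeasurableSpace M] (g : SmoothMetric I M) (p : ℝ × ℝ → M) (s : M → ℝ × ℝ)
    (V : M → ℝ) : Prop :=
  ∀ f : M → ℝ, ContMDiff I 𝓘(ℝ, ℝ) 1 f → HasCompactSupport f →
    0 ≤ ∫ m, (normSqDiff g p s f m + V m * f m ^ 2) ∂(riemMeasure g p s)

/-- The set `I(M, g; V) = {a ∈ ℝ | Δ + a V ≥ 0}`. -/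
def nonnegSet [MeasurableSpace M] (g : SmoothMetric I M) (p : ℝ × ℝ → M) (s : M → ℝ × ℝ)
    (V : M → ℝ) : Set ℝ :=
  {a | IsNonnegative g p s (fun m => a * V m)}

end Surface

/-! ### The plane and the cylinder -/

/-- The model of the plane `ℝ²` as a manifold. -/
abbrev planeModel : ModelWithCorners ℝ (ℝ × ℝ) (ℝ × ℝ) := 𝓘(ℝ, ℝ × ℝ)

/-- The model of the cylinder `S¹ × ℝ` as a product manifold. -/
abbrev cylModel : ModelWithCorners ℝ (EuclideanSpace ℝ (Fin 1) × ℝ)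
    (ModelProd (EuclideanSpace ℝ (Fin 1)) ℝ) := (𝓡 1).prod 𝓘(ℝ, ℝ)

/-- Global coordinates on the plane: the identity. -/
def planeParam : ℝ × ℝ → ℝ × ℝ := id

/-- The coordinates of a point of the plane. -/
def planeCoord : ℝ × ℝ → ℝ × ℝ := id

/-- The universal covering `(θ, t) ↦ (exp(iθ), t)` of the cylinder. -/
def cylParam (x : ℝ × ℝ) : Circle × ℝ := (Circle.exp x.1, x.2)

/-- The coordinates `(θ, t)`, with `-π < θ ≤ π`, of a point of the cylinder. -/
def cylCoord (m : Circle × ℝ) : ℝ × ℝ := (Complex.arg (m.1 : ℂ), m.2)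

theorem cylParam_cylCoord (m : Circle × ℝ) : cylParam (cylCoord m) = m :=
  Prod.ext (Circle.exp_arg m.1) rfl

theorem range_cylCoord : Set.range cylCoord = Set.Ioc (-Real.pi) Real.pi ×ˢ Set.univ := by
  ext x
  constructor
  · rintro ⟨m, rfl⟩
    exact ⟨⟨Complex.neg_pi_lt_arg _, Complex.arg_le_pi _⟩, trivial⟩
  · rintro ⟨h, -⟩
    exact ⟨cylParam x, Prod.ext (Circle.arg_exp h.1 h.2) rfl⟩

/-- The translation action of `ℤ²` on the plane. -/
def planeShift (k : ℤ × ℤ) (x : ℝ × ℝ) : ℝ × ℝ := (x.1 + k.1, x.2 + k.2)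

/-- The translation action of `ℤ` on the second factor of the cylinder. -/
def cylShift (k : ℤ) (m : Circle × ℝ) : Circle × ℝ := (m.1, m.2 + k)

instance : MeasurableSpace Circle := borel Circle

instance : BorelSpace Circle := ⟨rfl⟩

end PeriodicSurface

end

namespace PeriodicSurface

/-! ### Calculus with partial derivatives -/

section PartialDeriv

variable {u v : ℝ × ℝ → ℝ} {x : ℝ × ℝ}

/-! Suppose `a` belongs to the set. In the coordinates `p` the metric becomes a doubly periodic
metric on `ℝ²`, with cell a unit square for the plane and `2π × 1` for the cylinder. The first point
is that the quadratic form is then non-negative on the quotient torus, that is, on one cell for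
every doubly periodic `C¹` function `u`. Multiply `u` by a cut-off `ψ` which is 1 on a block of
cells and has uniformly bounded derivatives. The block contributes (number of cells) × (energy of
`u` on a cell), while the transition region contributes at most a constant times its area. For the
plane this compares `n²` with `O(n)`, for the cylinder `n` with `O(1)`, so the energy per cell is
non-negative (`plane_cell_energy_nonneg`, `cyl_cell_energy_nonneg`).

The second point is Gauss–Bonnet, `IsMetric.setIntegral_curvature`: the curvature form is exact with
a periodic primitive, so its integral over a cell is zero. Hence the constant 1 has energy 0 and
minimises a non-negative form. Its first variation in the direction `K` is `2a ∫ K²`, which must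
vanish; if `a ≠ 0` then `K = 0` (`IsMetric.curvature_eq_zero`).

The rest is immediate: for `a = 0` or `K = 0` the form is the Dirichlet integral
(`nonnegSet_dichotomy`). -/

theorem partialDeriv_add (i : Fin 2) (hu : DifferentiableAt ℝ u x) (hv : DifferentiableAt ℝ v x) :
    partialDeriv i (fun y => u y + v y) x = partialDeriv i u x + partialDeriv i v x := by
  simp [partialDeriv, fderiv_fun_add hu hv]

theorem partialDeriv_sub (i : Fin 2) (hu : DifferentiableAt ℝ u x) (hv : DifferentiableAt ℝ v x) :
    partialDeriv i (fun y => u y - v y) x = partialDeriv i u x - partialDeriv i v x := by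
  simp [partialDeriv, fderiv_fun_sub hu hv]

theorem partialDeriv_mul (i : Fin 2) (hu : DifferentiableAt ℝ u x) (hv : DifferentiableAt ℝ v x) :
    partialDeriv i (fun y => u y * v y) x = partialDeriv i u x * v x + u x * partialDeriv i v x := by
  simp [partialDeriv, fderiv_fun_mul hu hv]
  ring

theorem partialDeriv_const_mul (i : Fin 2) (c : ℝ) (hu : DifferentiableAt ℝ u x) :
    partialDeriv i (fun y => c * u y) x = c * partialDeriv i u x := by
  simp [partialDeriv, fderiv_const_mul hu]

theorem partialDeriv_inv (i : Fin 2) (hu : DifferentiableAt ℝ u x) (h : u x ≠ 0) :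
    partialDeriv i (fun y => (u y)⁻¹) x = -partialDeriv i u x / u x ^ 2 := by
  have := (hasDerivAt_inv h).comp_hasFDerivAt x hu.hasFDerivAt
  have h2 : fderiv ℝ (fun y => (u y)⁻¹) x = _ := this.fderiv
  simp [partialDeriv, h2]
  ring

theorem partialDeriv_sqrt (i : Fin 2) (hu : DifferentiableAt ℝ u x) (h : u x ≠ 0) :
    partialDeriv i (fun y => √(u y)) x = partialDeriv i u x / (2 * √(u x)) := by
  simp [partialDeriv, fderiv_sqrt hu h]
  ring

theorem contDiff_partialDeriv (i : Fin 2) (hu : ContDiff ℝ ∞ u) :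
    ContDiff ℝ ∞ (partialDeriv i u) :=
  (hu.fderiv_right (m := ∞) le_rfl).clm_apply contDiff_const

theorem continuous_partialDeriv (i : Fin 2) (hu : ContDiff ℝ 1 u) :
    Continuous (partialDeriv i u) :=
  (hu.continuous_fderiv one_ne_zero).clm_apply continuous_const

theorem partialDeriv_comm (i j : Fin 2) (hu : ContDiff ℝ ∞ u) (x : ℝ × ℝ) :
    partialDeriv i (partialDeriv j u) x = partialDeriv j (partialDeriv i u) x := by
  have hd : DifferentiableAt ℝ (fderiv ℝ u) x :=
    (hu.fderiv_right (m := ∞) le_rfl).differentiable (by simp) x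
  have h (k l : Fin 2) : partialDeriv k (partialDeriv l u) x = fderiv ℝ (fderiv ℝ u) x (e k) (e l) := by
    have : partialDeriv l u = fun y => fderiv ℝ u y (e l) := rfl
    rw [partialDeriv, this, fderiv_clm_apply hd (differentiableAt_const _)]
    simp
  rw [h, h]
  exact (contDiff_infty.1 hu 2).contDiffAt.isSymmSndFDerivAt (by simp) _ _

theorem partialDeriv_comp_add (i : Fin 2) (c : ℝ × ℝ) :
    partialDeriv i (fun y => u (y + c)) x = partialDeriv i u (x + c) := by
  simp [partialDeriv, fderiv_comp_add_right]

theorem partialDeriv_congr (i : Fin 2) (h : u =ᶠ[nhds x] v) :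
    partialDeriv i u x = partialDeriv i v x := by
  simp [partialDeriv, h.fderiv_eq]

end PartialDeriv

/-! ### Metrics in coordinates -/

/-- The matrix-valued function `G` gives the coefficients of a smooth Riemannian metric. -/
structure IsMetric (G : ℝ × ℝ → Matrix (Fin 2) (Fin 2) ℝ) : Prop where
  contDiff : ∀ i j, ContDiff ℝ ∞ fun x => G x i j
  posDef : ∀ x, (G x).PosDef

namespace IsMetric

variable {G : ℝ × ℝ → Matrix (Fin 2) (Fin 2) ℝ}

theorem symm (h : IsMetric G) (x : ℝ × ℝ) (i j : Fin 2) : G x i j = G x j i := by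
  simpa using ((h.posDef x).isHermitian.apply i j).symm

theorem det_pos (h : IsMetric G) (x : ℝ × ℝ) : 0 < (G x).det := (h.posDef x).det_pos

theorem diag_pos (h : IsMetric G) (x : ℝ × ℝ) (i : Fin 2) : 0 < G x i i := (h.posDef x).diag_pos

theorem contDiff_det (h : IsMetric G) : ContDiff ℝ ∞ fun x => (G x).det := by
  simp only [Matrix.det_fin_two]
  exact ((h.contDiff 0 0).mul (h.contDiff 1 1)).sub ((h.contDiff 0 1).mul (h.contDiff 1 0))

theorem contDiff_sqrt_det (h : IsMetric G) : ContDiff ℝ ∞ fun x => √(G x).det :=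
  h.contDiff_det.sqrt fun x => (h.det_pos x).ne'

theorem contDiff_inv (h : IsMetric G) (i j : Fin 2) : ContDiff ℝ ∞ fun x => (G x)⁻¹ i j := by
  have : (fun x => (G x)⁻¹ i j) = fun x => ((G x).det)⁻¹ * (G x).adjugate i j := by
    ext x
    simp [Matrix.inv_def]
  rw [this]
  refine (h.contDiff_det.inv fun x => (h.det_pos x).ne').mul ?_
  simp only [Matrix.adjugate_fin_two]
  fin_cases i <;> fin_cases j <;> simp [h.contDiff, (h.contDiff _ _).neg]

theorem contDiff_christoffel (h : IsMetric G) (k i j : Fin 2) :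
    ContDiff ℝ ∞ (christoffel G k i j) := by
  unfold christoffel
  refine contDiff_const.mul (ContDiff.sum fun l _ => (h.contDiff_inv k l).mul ?_)
  exact ((contDiff_partialDeriv _ (h.contDiff _ _)).add
    (contDiff_partialDeriv _ (h.contDiff _ _))).sub (contDiff_partialDeriv _ (h.contDiff _ _))

theorem contDiff_riemann (h : IsMetric G) (l k i j : Fin 2) :
    ContDiff ℝ ∞ (riemann G l k i j) := by
  unfold riemann
  refine ((contDiff_partialDeriv _ (h.contDiff_christoffel _ _ _)).sub
    (contDiff_partialDeriv _ (h.contDiff_christoffel _ _ _))).add (ContDiff.sum fun m _ => ?_)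
  exact ((h.contDiff_christoffel _ _ _).mul (h.contDiff_christoffel _ _ _)).sub
    ((h.contDiff_christoffel _ _ _).mul (h.contDiff_christoffel _ _ _))

theorem contDiff_curvature (h : IsMetric G) : ContDiff ℝ ∞ (coordGaussCurvature G) := by
  unfold coordGaussCurvature
  exact (ContDiff.sum fun l _ => (h.contDiff_riemann _ _ _ _).mul (h.contDiff _ _)).div
    h.contDiff_det fun x => (h.det_pos x).ne'

theorem christoffel_symm (h : IsMetric G) (k i j : Fin 2) (x : ℝ × ℝ) :
    christoffel G k i j x = christoffel G k j i x := by
  have : (fun y => G y i j) = fun y => G y j i := funext fun y => h.symm y i j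
  simp only [christoffel, this]
  congr 1
  refine Finset.sum_congr rfl fun l _ => ?_
  ring

/-- Lowering the upper index cancels the inverse matrix and leaves the Christoffel symbols of the
first kind. -/
theorem sum_mul_christoffel (h : IsMetric G) (l i j : Fin 2) (x : ℝ × ℝ) :
    ∑ m, G x l m * christoffel G m i j x = (1 / 2 : ℝ) *
      (partialDeriv i (fun y => G y j l) x + partialDeriv j (fun y => G y i l) x
        - partialDeriv l (fun y => G y i j) x) := by
  set c : Fin 2 → ℝ := fun l => partialDeriv i (fun y => G y j l) x +
    partialDeriv j (fun y => G y i l) x - partialDeriv l (fun y => G y i j) x with hc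
  have h1 : (G x).mulVec ((G x)⁻¹.mulVec c) = c := by
    rw [Matrix.mulVec_mulVec, Matrix.mul_nonsing_inv _ (h.det_pos x).ne'.isUnit,
      Matrix.one_mulVec]
  have h2 := congrFun h1 l
  simp only [Matrix.mulVec, dotProduct, Fin.sum_univ_two] at h2
  simp only [christoffel, Fin.sum_univ_two]
  linear_combination (1 / 2 : ℝ) * h2

/-- The Levi-Civita connection is compatible with the metric. -/
theorem partialDeriv_metric (h : IsMetric G) (i j l : Fin 2) (x : ℝ × ℝ) :
    partialDeriv i (fun y => G y j l) x =
      ∑ m, (G x l m * christoffel G m i j x + G x j m * christoffel G m i l x) := by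
  have hs (a b : Fin 2) : (fun y => G y a b) = fun y => G y b a := funext fun y => h.symm y a b
  rw [Finset.sum_add_distrib, h.sum_mul_christoffel, h.sum_mul_christoffel, hs l j, hs i j, hs i l]
  ring

theorem differentiableAt (h : IsMetric G) (i j : Fin 2) (x : ℝ × ℝ) :
    DifferentiableAt ℝ (fun y => G y i j) x := (h.contDiff i j).differentiable (by simp) x

theorem differentiableAt_christoffel (h : IsMetric G) (k i j : Fin 2) (x : ℝ × ℝ) :
    DifferentiableAt ℝ (christoffel G k i j) x :=
  (h.contDiff_christoffel k i j).differentiable (by simp) x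

/-- `R(∂₁, ∂₂)∂₂` is orthogonal to `∂₂`. -/
theorem riemann_orthogonal (h : IsMetric G) (x : ℝ × ℝ) :
    G x 0 1 * riemann G 0 1 0 1 x + G x 1 1 * riemann G 1 1 0 1 x = 0 := by
  have hp (i : Fin 2) : partialDeriv i (fun y => G y 1 1) = fun y =>
      2 * (G y 0 1 * christoffel G 0 i 1 y + G y 1 1 * christoffel G 1 i 1 y) := by
    ext y
    rw [h.partialDeriv_metric]
    simp only [Fin.sum_univ_two, h.symm y 1 0]
    ring
  have hd (j i : Fin 2) : partialDeriv j (partialDeriv i (fun y => G y 1 1)) x =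
      2 * (partialDeriv j (fun y => G y 0 1) x * christoffel G 0 i 1 x
        + G x 0 1 * partialDeriv j (christoffel G 0 i 1) x
        + (partialDeriv j (fun y => G y 1 1) x * christoffel G 1 i 1 x
        + G x 1 1 * partialDeriv j (christoffel G 1 i 1) x)) := by
    have d1 := h.differentiableAt 0 1 x
    have d2 := h.differentiableAt 1 1 x
    have d3 := h.differentiableAt_christoffel 0 i 1 x
    have d4 := h.differentiableAt_christoffel 1 i 1 x
    rw [hp i, partialDeriv_const_mul, partialDeriv_add, partialDeriv_mul, partialDeriv_mul] <;>
      fun_prop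
  -- The commutator of the second derivatives of `|∂₂|²` is `2⟨R(∂₁, ∂₂)∂₂, ∂₂⟩`, hence zero.
  have hc := partialDeriv_comm 0 1 (h.contDiff 1 1) x
  rw [hd, hd, h.partialDeriv_metric 0 0 1, h.partialDeriv_metric 1 0 1,
    h.partialDeriv_metric 0 1 1, h.partialDeriv_metric 1 1 1] at hc
  simp only [Fin.sum_univ_two, h.symm x 1 0, h.christoffel_symm _ 1 0] at hc
  simp only [riemann, Fin.sum_univ_two, h.christoffel_symm _ 1 0]
  linear_combination (1 / 2 : ℝ) * hc

/-- Orthogonality to `∂₂` eliminates the second component of `R(∂₁, ∂₂)∂₂`, so a single component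
determines the curvature. -/
theorem curvature_eq (h : IsMetric G) (x : ℝ × ℝ) :
    coordGaussCurvature G x = riemann G 0 1 0 1 x / G x 1 1 := by
  have h1 := h.riemann_orthogonal x
  have h2 := (h.det_pos x).ne'
  have h3 := (h.diag_pos x 1).ne'
  rw [coordGaussCurvature, div_eq_div_iff h2 h3, Matrix.det_fin_two]
  simp only [Fin.sum_univ_two, h.symm x 1 0]
  linear_combination G x 0 1 * h1

/-- The components of the connection form of the orthonormal frame whose second vector is
`∂₂ / |∂₂|`. -/
noncomputable def connectionForm (G : ℝ × ℝ → Matrix (Fin 2) (Fin 2) ℝ) (i : Fin 2) (x : ℝ × ℝ) : ℝ :=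
  √(G x).det * (G x 1 1)⁻¹ * christoffel G 0 i 1 x

theorem contDiff_connectionForm (h : IsMetric G) (i : Fin 2) :
    ContDiff ℝ ∞ (connectionForm G i) :=
  (h.contDiff_sqrt_det.mul ((h.contDiff 1 1).inv fun x => (h.diag_pos x 1).ne')).mul
    (h.contDiff_christoffel 0 i 1)

theorem partialDeriv_det (h : IsMetric G) (i : Fin 2) (x : ℝ × ℝ) :
    partialDeriv i (fun y => (G y).det) x =
      2 * (G x).det * (christoffel G 0 i 0 x + christoffel G 1 i 1 x) := by
  have d00 := h.differentiableAt 0 0 x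
  have d01 := h.differentiableAt 0 1 x
  have d10 := h.differentiableAt 1 0 x
  have d11 := h.differentiableAt 1 1 x
  simp only [Matrix.det_fin_two]
  rw [partialDeriv_sub _ (by fun_prop) (by fun_prop), partialDeriv_mul _ d00 d11,
    partialDeriv_mul _ d01 d10]
  simp only [h.partialDeriv_metric, Fin.sum_univ_two, h.symm x 1 0]
  ring

/-- The curvature form is the differential of the connection form. -/
theorem curvature_mul_sqrt_det (h : IsMetric G) (x : ℝ × ℝ) :
    coordGaussCurvature G x * √(G x).det =
      partialDeriv 0 (connectionForm G 1) x - partialDeriv 1 (connectionForm G 0) x := by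
  have hD := (h.det_pos x).ne'
  have hH := (h.diag_pos x 1).ne'
  have hS : √(G x).det ≠ 0 := (Real.sqrt_pos.2 (h.det_pos x)).ne'
  have dD : DifferentiableAt ℝ (fun y => (G y).det) x := h.contDiff_det.differentiable (by simp) x
  have dS : DifferentiableAt ℝ (fun y => √(G y).det) x :=
    h.contDiff_sqrt_det.differentiable (by simp) x
  have dH := h.differentiableAt 1 1 x
  have dI : DifferentiableAt ℝ (fun y => (G y 1 1)⁻¹) x := dH.inv hH
  -- The last factor collects the logarithmic derivatives of `√det` and of `1 / G₂₂`. Its final term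
  -- gives a product symmetric in `i` and `j`, which drops out of the exterior derivative.
  have key (j i : Fin 2) : partialDeriv j (connectionForm G i) x =
      √(G x).det * (G x 1 1)⁻¹ * (partialDeriv j (christoffel G 0 i 1) x
        + christoffel G 0 i 1 x * (christoffel G 0 j 0 x - christoffel G 1 j 1 x
          - 2 * G x 0 1 * (G x 1 1)⁻¹ * christoffel G 0 j 1 x)) := by
    unfold connectionForm
    rw [partialDeriv_mul _ (dS.fun_mul dI) (h.differentiableAt_christoffel 0 i 1 x),
      partialDeriv_mul _ dS dI, partialDeriv_sqrt _ dD hD, partialDeriv_inv _ dH hH,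
      h.partialDeriv_det, h.partialDeriv_metric]
    simp only [Fin.sum_univ_two, h.symm x 1 0]
    have hSS : (G x).det = √(G x).det * √(G x).det :=
      (Real.mul_self_sqrt (h.det_pos x).le).symm
    generalize √(G x).det = S at *
    rw [hSS]
    field_simp
    ring
  rw [key, key, h.curvature_eq]
  simp only [riemann, Fin.sum_univ_two, h.christoffel_symm _ 1 0]
  field_simp
  ring

end IsMetric

end PeriodicSurface

namespace PeriodicSurface

open MeasureTheory Set

/-! ### Doubly periodic functions on the plane -/

/-- The fundamental cell `(x₀, x₀ + T] × (0, 1]`. -/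
def cell (x₀ T : ℝ) : Set (ℝ × ℝ) := Ioc x₀ (x₀ + T) ×ˢ Ioc 0 1

/-- `F` is periodic with periods `(T, 0)` and `(0, 1)`. -/
structure DoublyPeriodic {α : Type*} (T : ℝ) (F : ℝ × ℝ → α) : Prop where
  fst : Function.Periodic F (T, 0)
  snd : Function.Periodic F (0, 1)

namespace DoublyPeriodic

variable {T : ℝ}

theorem comp₂ {α β γ : Type*} {F : ℝ × ℝ → α} {F' : ℝ × ℝ → β} (h : DoublyPeriodic T F)
    (h' : DoublyPeriodic T F') (φ : α → β → γ) : DoublyPeriodic T fun x => φ (F x) (F' x) :=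
  ⟨fun x => by simp only [h.fst x, h'.fst x], fun x => by simp only [h.snd x, h'.snd x]⟩

theorem comp {α β : Type*} {F : ℝ × ℝ → α} (h : DoublyPeriodic T F) (φ : α → β) :
    DoublyPeriodic T fun x => φ (F x) :=
  h.comp₂ h fun a _ => φ a

theorem exists_mem_cell {α : Type*} {F : ℝ × ℝ → α} (h : DoublyPeriodic T F) (hT : 0 < T)
    (x₀ : ℝ) (x : ℝ × ℝ) : ∃ y ∈ cell x₀ T, F x = F y := by
  refine ⟨(toIocMod hT x₀ x.1, toIocMod one_pos 0 x.2), ⟨toIocMod_mem_Ioc hT _ _, ?_⟩, ?_⟩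
  · simpa using toIocMod_mem_Ioc (one_pos : (0 : ℝ) < 1) 0 x.2
  · have h1 := (h.fst.zsmul (toIocDiv hT x₀ x.1)) (toIocMod hT x₀ x.1, toIocMod one_pos 0 x.2)
    have h2 := (h.snd.zsmul (toIocDiv one_pos 0 x.2)) (x.1, toIocMod one_pos 0 x.2)
    rw [← h1]
    simp only [Prod.smul_mk, smul_zero, Prod.mk_add_mk, add_zero, toIocMod_add_toIocDiv_zsmul]
      at h2 ⊢
    rw [← h2]

theorem exists_bound {F : ℝ × ℝ → ℝ} (h : DoublyPeriodic T F) (hT : 0 < T) (hF : Continuous F) :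
    ∃ B, ∀ x, |F x| ≤ B := by
  obtain ⟨B, hB⟩ := (isCompact_Icc.prod isCompact_Icc : IsCompact (Icc 0 (0 + T) ×ˢ
    Icc (0 : ℝ) 1)).exists_bound_of_continuousOn hF.continuousOn
  refine ⟨B, fun x => ?_⟩
  obtain ⟨y, hy, hxy⟩ := h.exists_mem_cell hT 0 x
  rw [hxy]
  exact hB y (prod_mono Ioc_subset_Icc_self Ioc_subset_Icc_self hy)

end DoublyPeriodic

/-! ### Integrals over blocks of fundamental cells. -/

theorem integrableOn_Ioc_prod {F : ℝ × ℝ → ℝ} (hF : Continuous F) (a b c d : ℝ) :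
    IntegrableOn F (Ioc a b ×ˢ Ioc c d) :=
  (hF.continuousOn.integrableOn_compact (isCompact_Icc.prod isCompact_Icc)).mono_set
    (prod_mono Ioc_subset_Icc_self Ioc_subset_Icc_self)

theorem setIntegral_Ioc_prod {F : ℝ × ℝ → ℝ} (hF : Continuous F) {a b c d : ℝ} (hab : a ≤ b)
    (hcd : c ≤ d) : ∫ z in Ioc a b ×ˢ Ioc c d, F z = ∫ x in a..b, ∫ y in c..d, F (x, y) := by
  rw [Measure.volume_eq_prod, setIntegral_prod _ (integrableOn_Ioc_prod hF a b c d)]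
  simp only [intervalIntegral.integral_of_le, hab, hcd]

theorem setIntegral_cells {T : ℝ} (hT : 0 < T) (x₀ : ℝ) {F : ℝ × ℝ → ℝ} (h : DoublyPeriodic T F)
    (hF : Continuous F) (m n : ℕ) :
    ∫ z in Ioc x₀ (x₀ + m * T) ×ˢ Ioc 0 (n : ℝ), F z = m * n * ∫ z in cell x₀ T, F z := by
  rw [cell, setIntegral_Ioc_prod hF (by simp; positivity) (by positivity),
    setIntegral_Ioc_prod hF (by linarith) zero_le_one]
  have h1 (x : ℝ) : ∫ y in (0 : ℝ)..n, F (x, y) = n * ∫ y in (0 : ℝ)..1, F (x, y) := by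
    have hp : Function.Periodic (fun y => F (x, y)) 1 := fun y => by
      simpa using h.snd (x, y)
    have := hp.intervalIntegral_add_zsmul_eq n 0
      fun _ _ => (by fun_prop : Continuous fun y => F (x, y)).intervalIntegrable _ _
    simpa using this
  have hp : Function.Periodic (fun x => ∫ y in (0 : ℝ)..1, F (x, y)) T := fun x => by
    refine intervalIntegral.integral_congr fun y _ => ?_
    simpa using h.fst (x, y)
  have hc : Continuous fun x => ∫ y in (0 : ℝ)..1, F (x, y) :=
    intervalIntegral.continuous_parametric_intervalIntegral_of_continuous' (f := fun x y => F (x, y))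
      hF 0 1
  have h2 := hp.intervalIntegral_add_zsmul_eq m x₀ fun _ _ => hc.intervalIntegrable _ _
  simp only [h1, intervalIntegral.integral_const_mul]
  simp only [natCast_zsmul, nsmul_eq_mul] at h2
  rw [h2]
  ring

theorem eq_zero_of_setIntegral_cell {T : ℝ} (hT : 0 < T) (x₀ : ℝ) {F : ℝ × ℝ → ℝ}
    (h : DoublyPeriodic T F) (hF : Continuous F) (h0 : ∀ x, 0 ≤ F x)
    (hi : ∫ z in cell x₀ T, F z = 0) (x : ℝ × ℝ) : F x = 0 := by
  have h1 := (setIntegral_eq_zero_iff_of_nonneg_ae (Filter.Eventually.of_forall h0)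
    (integrableOn_Ioc_prod hF _ _ _ _)).1 hi
  have h2 : EqOn F 0 (cell x₀ T) := by
    -- Almost everywhere equality becomes equality by continuity, because the half-open cell lies in
    -- the closure of its interior.
    refine Measure.eqOn_of_ae_eq h1 hF.continuousOn continuousOn_const ?_
    rw [cell, interior_prod_eq, interior_Ioc, interior_Ioc, closure_prod_eq,
      closure_Ioo (by linarith), closure_Ioo zero_ne_one]
    exact prod_mono Ioc_subset_Icc_self Ioc_subset_Icc_self
  obtain ⟨y, hy, hxy⟩ := h.exists_mem_cell hT x₀ x
  rw [hxy, h2 hy]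
  rfl

/-! ### Periodic metrics -/

section Periodic

variable {G : ℝ × ℝ → Matrix (Fin 2) (Fin 2) ℝ} {T : ℝ}

theorem periodic_partialDeriv {u : ℝ × ℝ → ℝ} {c : ℝ × ℝ} (h : Function.Periodic u c) (i : Fin 2) :
    Function.Periodic (partialDeriv i u) c := fun x => by
  rw [← partialDeriv_comp_add, show (fun y => u (y + c)) = u from funext h]

theorem DoublyPeriodic.partialDeriv {u : ℝ × ℝ → ℝ} (h : DoublyPeriodic T u) (i : Fin 2) :
    DoublyPeriodic T (partialDeriv i u) :=
  ⟨periodic_partialDeriv h.fst i, periodic_partialDeriv h.snd i⟩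

theorem periodic_christoffel {c : ℝ × ℝ} (h : Function.Periodic G c) (k i j : Fin 2) :
    Function.Periodic (christoffel G k i j) c := fun x => by
  have h' (a b : Fin 2) : Function.Periodic (fun y => G y a b) c := fun y => by simp only [h y]
  simp only [christoffel, h x, periodic_partialDeriv (h' _ _) _ x]

theorem periodic_curvature {c : ℝ × ℝ} (h : Function.Periodic G c) :
    Function.Periodic (coordGaussCurvature G) c := fun x => by
  simp only [coordGaussCurvature, riemann, h x, periodic_christoffel h _ _ _ x,
    periodic_partialDeriv (periodic_christoffel h _ _ _) _ x]

theorem DoublyPeriodic.curvature (h : DoublyPeriodic T G) :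
    DoublyPeriodic T (coordGaussCurvature G) :=
  ⟨periodic_curvature h.fst, periodic_curvature h.snd⟩

theorem DoublyPeriodic.connectionForm (h : DoublyPeriodic T G) (i : Fin 2) :
    DoublyPeriodic T (IsMetric.connectionForm G i) :=
  ⟨fun x => by simp only [IsMetric.connectionForm, h.fst x, periodic_christoffel h.fst _ _ _ x],
    fun x => by simp only [IsMetric.connectionForm, h.snd x, periodic_christoffel h.snd _ _ _ x]⟩

/-- The Gauss–Bonnet theorem for a torus. -/
theorem IsMetric.setIntegral_curvature (hG : IsMetric G) (h : DoublyPeriodic T G) (hT : 0 < T)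
    (x₀ : ℝ) : ∫ z in cell x₀ T, coordGaussCurvature G z * √(G z).det = 0 := by
  have hd (i : Fin 2) (x : ℝ × ℝ) :=
    ((hG.contDiff_connectionForm i).differentiable (by simp) x).hasFDerivAt
  have hc (i : Fin 2) := (hG.contDiff_connectionForm i).continuous
  have hcont : Continuous fun z => coordGaussCurvature G z * √(G z).det :=
    hG.contDiff_curvature.continuous.mul hG.contDiff_sqrt_det.continuous
  have heq (z : ℝ × ℝ) : coordGaussCurvature G z * √(G z).det =
      fderiv ℝ (connectionForm G 1) z (1, 0) + (-fderiv ℝ (connectionForm G 0) z) (0, 1) := by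
    rw [hG.curvature_mul_sqrt_det]
    simp [PeriodicSurface.partialDeriv, e, sub_eq_add_neg]
  have hi := integral2_divergence_prod_of_hasFDerivAt (connectionForm G 1)
    (fun x => -connectionForm G 0 x) (fderiv ℝ (connectionForm G 1))
    (fun z => -fderiv ℝ (connectionForm G 0) z) x₀ 0 (x₀ + T) 1
    (hc 1).continuousOn (hc 0).neg.continuousOn (fun x _ => hd 1 x) (fun x _ => (hd 0 x).neg)
    (by
      simp only [← heq]
      exact hcont.continuousOn.integrableOn_compact (isCompact_uIcc.prod isCompact_uIcc))
  rw [cell, setIntegral_Ioc_prod hcont (by linarith) zero_le_one]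
  simp only [heq]
  rw [hi]
  -- Periodicity of the connection form makes the contributions of opposite sides cancel.
  have h1 (x : ℝ) : connectionForm G 0 (x, 1) = connectionForm G 0 (x, 0) := by
    simpa using (h.connectionForm 0).snd (x, 0)
  have h2 (y : ℝ) : connectionForm G 1 (x₀ + T, y) = connectionForm G 1 (x₀, y) := by
    simpa using (h.connectionForm 1).fst (x₀, y)
  simp [h1, h2]

end Periodic

/-! ### The energy density -/

/-- The density `(|df|² + a K f²) √(det G)` of the quadratic form of `Δ + a K` in coordinates. -/
noncomputable def energyDensity (G : ℝ × ℝ → Matrix (Fin 2) (Fin 2) ℝ) (a : ℝ) (f : ℝ × ℝ → ℝ)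
    (x : ℝ × ℝ) : ℝ :=
  (∑ i, ∑ j, (G x)⁻¹ i j * partialDeriv i f x * partialDeriv j f x
    + a * coordGaussCurvature G x * f x ^ 2) * √(G x).det

section Energy

variable {G : ℝ × ℝ → Matrix (Fin 2) (Fin 2) ℝ} {T a : ℝ} {u : ℝ × ℝ → ℝ}

theorem energyDensity_congr {f f' : ℝ × ℝ → ℝ} {x : ℝ × ℝ} (h : f =ᶠ[nhds x] f') :
    energyDensity G a f x = energyDensity G a f' x := by
  simp only [energyDensity, partialDeriv_congr _ h, h.eq_of_nhds]

theorem IsMetric.continuous_energyDensity (hG : IsMetric G) (hu : ContDiff ℝ 1 u) :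
    Continuous (energyDensity G a u) := by
  have h1 (i j : Fin 2) := (hG.contDiff_inv i j).continuous
  have h2 (i : Fin 2) := continuous_partialDeriv i hu
  have h3 := hu.continuous
  have h4 := hG.contDiff_curvature.continuous
  have h5 := hG.contDiff_sqrt_det.continuous
  unfold energyDensity
  refine Continuous.mul (Continuous.add ?_ ((continuous_const.mul h4).mul (h3.pow 2))) h5
  exact continuous_finsetSum _ fun i _ => continuous_finsetSum _ fun j _ =>
    ((h1 i j).mul (h2 i)).mul (h2 j)

theorem DoublyPeriodic.energyDensity (hG : DoublyPeriodic T G) (hu : DoublyPeriodic T u) :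
    DoublyPeriodic T (energyDensity G a u) :=
  ⟨fun x => by
    simp only [PeriodicSurface.energyDensity, hG.fst x, (hu.partialDeriv _).fst x, hu.fst x,
      hG.curvature.fst x],
   fun x => by
    simp only [PeriodicSurface.energyDensity, hG.snd x, (hu.partialDeriv _).snd x, hu.snd x,
      hG.curvature.snd x]⟩

theorem IsMetric.normSq_nonneg (hG : IsMetric G) (f : ℝ × ℝ → ℝ) (x : ℝ × ℝ) :
    0 ≤ ∑ i, ∑ j, (G x)⁻¹ i j * partialDeriv i f x * partialDeriv j f x := by
  have := (hG.posDef x).inv.posSemidef.dotProduct_mulVec_nonneg fun i => partialDeriv i f x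
  refine this.trans_eq ?_
  simp only [dotProduct, Matrix.mulVec, Finset.mul_sum, Pi.star_apply, star_trivial]
  refine Finset.sum_congr rfl fun i _ => Finset.sum_congr rfl fun j _ => ?_
  ring

/-- Products of a periodic function with a cut-off function have an energy density which is
bounded in terms of the bounds for the cut-off function and its derivatives. -/
theorem IsMetric.exists_energyDensity_bound (hG : IsMetric G) (hper : DoublyPeriodic T G)
    (hT : 0 < T) (hu : ContDiff ℝ 1 u) (hup : DoublyPeriodic T u) (a L : ℝ) :
    ∃ C, 0 ≤ C ∧ ∀ ψ : ℝ × ℝ → ℝ, ContDiff ℝ 1 ψ → (∀ x, |ψ x| ≤ 1) →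
      (∀ i x, |partialDeriv i ψ x| ≤ L) →
      ∀ x, |energyDensity G a (fun y => u y * ψ y) x| ≤ C := by
  -- All coefficients of the form, as well as `u` and its derivatives, are continuous and periodic,
  -- hence bounded on the whole plane.
  have hinv (i j : Fin 2) : ∃ B, ∀ x, |(G x)⁻¹ i j * √(G x).det| ≤ B :=
    (hper.comp fun A => A⁻¹ i j * √A.det).exists_bound hT
      ((hG.contDiff_inv i j).continuous.mul hG.contDiff_sqrt_det.continuous)
  choose B₁ hB₁ using hinv
  obtain ⟨B₂, hB₂⟩ := (hper.curvature.comp₂ (hper.comp fun A => √A.det) (· * ·)).exists_bound hT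
    (hG.contDiff_curvature.continuous.mul hG.contDiff_sqrt_det.continuous)
  obtain ⟨B₃, hB₃⟩ := hup.exists_bound hT hu.continuous
  have hd (i : Fin 2) : ∃ B, ∀ x, |partialDeriv i u x| ≤ B :=
    (hup.partialDeriv i).exists_bound hT (continuous_partialDeriv i hu)
  choose B₄ hB₄ using hd
  set D : Fin 2 → ℝ := fun i => B₄ i + B₃ * L with hD
  have hB₃0 : 0 ≤ B₃ := (abs_nonneg _).trans (hB₃ 0)
  have key : ∀ ψ : ℝ × ℝ → ℝ, ContDiff ℝ 1 ψ → (∀ x, |ψ x| ≤ 1) →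
      (∀ i x, |partialDeriv i ψ x| ≤ L) →
      ∀ x, |energyDensity G a (fun y => u y * ψ y) x| ≤
        ∑ i, ∑ j, B₁ i j * D i * D j + |a| * B₂ * B₃ ^ 2 := by
    intro ψ hψ h1 h2 x
    have hp (i : Fin 2) : |partialDeriv i (fun y => u y * ψ y) x| ≤ D i := by
      rw [partialDeriv_mul _ (hu.differentiable (by simp) x) (hψ.differentiable (by simp) x), hD]
      refine (abs_add_le _ _).trans (add_le_add ?_ ?_)
      · rw [abs_mul]
        exact (mul_le_of_le_one_right (abs_nonneg _) (h1 x)).trans (hB₄ i x)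
      · rw [abs_mul]
        exact mul_le_mul (hB₃ x) (h2 i x) (abs_nonneg _) hB₃0
    have hf : |u x * ψ x| ≤ B₃ := by
      rw [abs_mul]
      exact (mul_le_of_le_one_right (abs_nonneg _) (h1 x)).trans (hB₃ x)
    have heq : energyDensity G a (fun y => u y * ψ y) x =
        ∑ i, ∑ j, ((G x)⁻¹ i j * √(G x).det) * partialDeriv i (fun y => u y * ψ y) x *
          partialDeriv j (fun y => u y * ψ y) x
        + a * (coordGaussCurvature G x * √(G x).det) * (u x * ψ x) ^ 2 := by
      simp only [energyDensity, Fin.sum_univ_two]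
      ring
    rw [heq]
    refine (abs_add_le _ _).trans (add_le_add ?_ ?_)
    · refine (Finset.abs_sum_le_sum_abs _ _).trans (Finset.sum_le_sum fun i _ => ?_)
      refine (Finset.abs_sum_le_sum_abs _ _).trans (Finset.sum_le_sum fun j _ => ?_)
      rw [abs_mul, abs_mul]
      have := (abs_nonneg _).trans (hB₁ i j x)
      have := (abs_nonneg _).trans (hp i)
      gcongr
      exacts [hB₁ i j x, hp i, hp j]
    · rw [abs_mul, abs_mul, abs_pow]
      have := (abs_nonneg _).trans (hB₂ x)
      gcongr
      exact hB₂ x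
  exact ⟨_, le_max_right _ 0, fun ψ h0 h1 h2 x => (key ψ h0 h1 h2 x).trans (le_max_left _ 0)⟩

/-- Comparison of the energy of a function cut off outside of `P` with the energy on `P`. -/
theorem setIntegral_energyDensity_le {C : ℝ} {ψ : ℝ × ℝ → ℝ} (hG : IsMetric G)
    (hu : ContDiff ℝ 1 u) (hψ : ContDiff ℝ 1 ψ)
    (hC : ∀ x, |energyDensity G a (fun y => u y * ψ y) x| ≤ C) {S P Q : Set (ℝ × ℝ)}
    (hS : MeasurableSet S) (hP : MeasurableSet P) (hQ : IsClosed Q) (hPS : P ⊆ S ∩ Q)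
    (hfin : volume (S ∩ Q) ≠ ⊤) (hψP : ∀ x ∈ P, ψ =ᶠ[nhds x] 1) (hψQ : ∀ x ∉ Q, ψ x = 0) :
    ∫ x in S, energyDensity G a (fun y => u y * ψ y) x ≤
      (∫ x in P, energyDensity G a u x) + C * (volume.real (S ∩ Q) - volume.real P) := by
  set f : ℝ × ℝ → ℝ := fun y => u y * ψ y with hf
  have hcont : Continuous (energyDensity G a f) := hG.continuous_energyDensity (hu.mul hψ)
  have hint : IntegrableOn (energyDensity G a f) (S ∩ Q) :=
    Measure.integrableOn_of_bounded hfin hcont.aestronglyMeasurable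
      (Filter.Eventually.of_forall hC)
  have hmeas : MeasurableSet (S ∩ Q) := hS.inter hQ.measurableSet
  have h0 : ∫ x in S, energyDensity G a f x = ∫ x in S ∩ Q, energyDensity G a f x := by
    -- The complement of `Q` is open, so there the function vanishes together with its derivatives.
    apply setIntegral_eq_of_subset_of_forall_sdiff_eq_zero hS inter_subset_left
    rintro x ⟨hxS, hx⟩
    have hx' : x ∈ Qᶜ := fun h => hx ⟨hxS, h⟩
    have : f =ᶠ[nhds x] fun _ => 0 := by
      filter_upwards [hQ.isOpen_compl.mem_nhds hx'] with y hy
      simp [hf, hψQ y hy]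
    rw [energyDensity_congr this]
    simp [energyDensity, partialDeriv]
  have h1 : ∫ x in P, energyDensity G a f x = ∫ x in P, energyDensity G a u x := by
    refine setIntegral_congr_fun hP fun x hx => energyDensity_congr ?_
    filter_upwards [hψP x hx] with y hy
    simp [hf, hy]
  have h2 : ∫ x in (S ∩ Q) \ P, energyDensity G a f x ≤
      C * (volume.real (S ∩ Q) - volume.real P) := by
    rw [← measureReal_sdiff hPS hP hfin]
    have hlt : volume ((S ∩ Q) \ P) < ⊤ := (measure_mono sdiff_subset).trans_lt hfin.lt_top
    exact (le_abs_self _).trans (norm_setIntegral_le_of_norm_le_const (f := energyDensity G a f)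
      hlt fun x _ => hC x)
  have h3 := setIntegral_union (μ := volume) (f := energyDensity G a f)
    (disjoint_sdiff_right (s := P) (t := S ∩ Q))
    (hmeas.diff hP) (hint.mono_set hPS) (hint.mono_set sdiff_subset)
  rw [union_sdiff_cancel hPS] at h3
  rw [h0, h3, h1]
  linarith

/-- If the energy over a fundamental cell is non-negative on all functions `1 + t K`, and
`a ≠ 0`, then the curvature vanishes. -/
theorem IsMetric.curvature_eq_zero (hG : IsMetric G) (hper : DoublyPeriodic T G) (hT : 0 < T)
    (x₀ : ℝ) (ha : a ≠ 0)
    (h : ∀ t : ℝ, 0 ≤ ∫ z in cell x₀ T, energyDensity G a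
      (fun y => 1 + t * coordGaussCurvature G y) z) (x : ℝ × ℝ) :
    coordGaussCurvature G x = 0 := by
  have hK := hG.contDiff_curvature
  have hKd (x : ℝ × ℝ) : DifferentiableAt ℝ (coordGaussCurvature G) x :=
    hK.differentiable (by simp) x
  have hKc := hK.continuous
  have hSc := hG.contDiff_sqrt_det.continuous
  have hEc : Continuous (energyDensity G a (coordGaussCurvature G)) :=
    hG.continuous_energyDensity (hK.of_le (by simp))
  set Z := ∫ z in cell x₀ T, coordGaussCurvature G z ^ 2 * √(G z).det with hZ
  set E := ∫ z in cell x₀ T, energyDensity G a (coordGaussCurvature G) z with hE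
  -- Gauss–Bonnet removes the term of degree 0 in `t`; the linear coefficient is the first variation
  -- at the constant 1.
  have hexp (t : ℝ) : ∫ z in cell x₀ T, energyDensity G a
      (fun y => 1 + t * coordGaussCurvature G y) z = t * (2 * a * Z + t * E) := by
    have hp (i : Fin 2) (z : ℝ × ℝ) : partialDeriv i (fun y => 1 + t * coordGaussCurvature G y) z
        = t * partialDeriv i (coordGaussCurvature G) z := by
      rw [partialDeriv_add _ (by fun_prop) ((hKd z).const_mul t),
        partialDeriv_const_mul _ _ (hKd z)]
      simp [partialDeriv]
    have h1 (z : ℝ × ℝ) : energyDensity G a (fun y => 1 + t * coordGaussCurvature G y) z =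
        a * (coordGaussCurvature G z * √(G z).det)
        + 2 * a * t * (coordGaussCurvature G z ^ 2 * √(G z).det)
        + t ^ 2 * energyDensity G a (coordGaussCurvature G) z := by
      simp only [energyDensity, hp, Fin.sum_univ_two]
      ring
    simp only [h1]
    have i1 : IntegrableOn (fun z => a * (coordGaussCurvature G z * √(G z).det)) (cell x₀ T) :=
      integrableOn_Ioc_prod (by fun_prop) _ _ _ _
    have i2 : IntegrableOn (fun z => 2 * a * t * (coordGaussCurvature G z ^ 2 * √(G z).det))
        (cell x₀ T) := integrableOn_Ioc_prod (by fun_prop) _ _ _ _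
    have i3 : IntegrableOn (fun z => t ^ 2 * energyDensity G a (coordGaussCurvature G) z)
        (cell x₀ T) := integrableOn_Ioc_prod (by fun_prop) _ _ _ _
    rw [integral_add (Integrable.fun_add i1 i2) i3, integral_add i1 i2, integral_const_mul, integral_const_mul,
      integral_const_mul, hG.setIntegral_curvature hper hT]
    ring
  simp only [hexp] at h
  have hZ0 : a * Z = 0 := by
    by_contra hne
    have hpos : 0 < |E| + 1 := by positivity
    -- For this `t`, opposite in sign to `a * Z` and small compared with `1 / |E|`, the linear term
    -- beats the quadratic one and the energy is negative.
    have := h (-(a * Z) / (|E| + 1))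
    have h2 : -(a * Z) / (|E| + 1) * (2 * a * Z + -(a * Z) / (|E| + 1) * E) =
        (a * Z) ^ 2 / (|E| + 1) ^ 2 * (E - 2 * (|E| + 1)) := by
      field_simp
      ring
    rw [h2] at this
    have h3 : 0 < (a * Z) ^ 2 / (|E| + 1) ^ 2 := by positivity
    have h4 : E - 2 * (|E| + 1) < 0 := by linarith [le_abs_self E, abs_nonneg E]
    exact absurd this (not_le.2 (mul_neg_of_pos_of_neg h3 h4))
  have := eq_zero_of_setIntegral_cell hT x₀
    (hper.curvature.comp₂ (hper.comp fun A => √A.det) fun k s => k ^ 2 * s)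
    ((hKc.pow 2).mul hSc) (fun x => by positivity) ((mul_eq_zero.1 hZ0).resolve_left ha) x
  have hs := (Real.sqrt_pos.2 (hG.det_pos x)).ne'
  simpa [hs] using this

end Energy

end PeriodicSurface

namespace PeriodicSurface

open MeasureTheory Set

/-! ### Cut-off functions -/

/-- The transition is constant on either side of `[0, 1]`, and its derivative is continuous on this
compact interval. -/
theorem exists_deriv_smoothTransition_bound : ∃ L, ∀ t, |deriv Real.smoothTransition t| ≤ L := by
  have hc : Continuous (deriv Real.smoothTransition) :=
    (Real.smoothTransition.contDiff (n := 1)).continuous_deriv le_rfl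
  obtain ⟨L, hL⟩ := (isCompact_Icc (a := (0 : ℝ)) (b := 1)).exists_bound_of_continuousOn
    hc.continuousOn
  have hL0 : 0 ≤ L := (norm_nonneg _).trans (hL 0 (by simp))
  refine ⟨L, fun t => ?_⟩
  by_cases ht : t ∈ Icc (0 : ℝ) 1
  · exact hL t ht
  · have : ∃ c : ℝ, Real.smoothTransition =ᶠ[nhds t] fun _ => c := by
      rcases lt_or_ge t 0 with h | h
      · refine ⟨0, ?_⟩
        filter_upwards [Iio_mem_nhds h] with y hy
        exact Real.smoothTransition.zero_of_nonpos (le_of_lt hy)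
      · have h1 : 1 < t := by
          by_contra h1
          exact ht ⟨h, not_lt.1 h1⟩
        refine ⟨1, ?_⟩
        filter_upwards [Ioi_mem_nhds h1] with y hy
        exact Real.smoothTransition.one_of_one_le (le_of_lt hy)
    obtain ⟨c, hc⟩ := this
    rw [hc.deriv_eq]
    simpa using hL0

/-- Smooth cut-off functions of the intervals `[0, n]`, with uniformly bounded derivatives. -/
theorem exists_cutoff : ∃ L, ∀ n : ℕ, ∃ χ : ℝ → ℝ, ContDiff ℝ ∞ χ ∧ (∀ t, |χ t| ≤ 1) ∧
    (∀ t, |deriv χ t| ≤ L) ∧ (∀ t ∈ Ioo (-1 : ℝ) (n + 1), χ t = 1) ∧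
    ∀ t ∉ Icc (-2 : ℝ) (n + 2), χ t = 0 := by
  obtain ⟨L, hL⟩ := exists_deriv_smoothTransition_bound
  have habs (t : ℝ) : |Real.smoothTransition t| ≤ 1 := by
    rw [abs_of_nonneg (Real.smoothTransition.nonneg t)]
    exact Real.smoothTransition.le_one t
  have hd : Differentiable ℝ Real.smoothTransition :=
    (Real.smoothTransition.contDiff (n := 1)).differentiable (by simp)
  have hs : ContDiff ℝ ∞ Real.smoothTransition := Real.smoothTransition.contDiff
  -- One factor rises on `[-2, -1]`, the other falls on `[n + 1, n + 2]`. The unit margins make the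
  -- product equal to 1 on a neighbourhood of `[0, n]`, and the product rule gives `L + L`,
  -- independently of `n`.
  refine ⟨L + L, fun n => ⟨fun t => Real.smoothTransition (t + 2) *
    Real.smoothTransition (n + 2 - t), ?_, fun t => ?_, fun t => ?_, fun t ht => ?_,
    fun t ht => ?_⟩⟩
  · fun_prop
  · rw [abs_mul]
    exact mul_le_one₀ (habs _) (abs_nonneg _) (habs _)
  · have h1 : HasDerivAt (fun t : ℝ => Real.smoothTransition (t + 2))
        (deriv Real.smoothTransition (t + 2)) t :=
      (hd (t + 2)).hasDerivAt.comp_add_const t 2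
    have h2 : HasDerivAt (fun t : ℝ => Real.smoothTransition (n + 2 - t))
        (-deriv Real.smoothTransition (n + 2 - t)) t :=
      (hd (n + 2 - t)).hasDerivAt.comp_const_sub (n + 2 : ℝ) t
    rw [(h1.fun_mul h2).deriv]
    refine (abs_add_le _ _).trans (add_le_add ?_ ?_)
    · rw [abs_mul]
      exact (mul_le_of_le_one_right (abs_nonneg _) (habs _)).trans (hL _)
    · rw [abs_mul, abs_neg]
      exact (mul_le_of_le_one_left (abs_nonneg _) (habs _)).trans (hL _)
  · simp only [Real.smoothTransition.one_of_one_le (show 1 ≤ t + 2 by linarith [ht.1]),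
      Real.smoothTransition.one_of_one_le (show 1 ≤ n + 2 - t by linarith [ht.2]), mul_one]
  · rcases lt_or_ge t (-2) with h | h
    · simp [Real.smoothTransition.zero_of_nonpos (show t + 2 ≤ 0 by linarith)]
    · have h1 : n + 2 < t := by
        by_contra h1
        exact ht ⟨h, not_lt.1 h1⟩
      simp [Real.smoothTransition.zero_of_nonpos (show n + 2 - t ≤ 0 by linarith)]

theorem abs_partialDeriv_prod_le {ξ χ : ℝ → ℝ} {L : ℝ} (hξ : Differentiable ℝ ξ)
    (hχ : Differentiable ℝ χ) (hξ1 : ∀ t, |ξ t| ≤ 1) (hχ1 : ∀ t, |χ t| ≤ 1)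
    (hξL : ∀ t, |deriv ξ t| ≤ L) (hχL : ∀ t, |deriv χ t| ≤ L) (i : Fin 2) (x : ℝ × ℝ) :
    |partialDeriv i (fun z : ℝ × ℝ => ξ z.1 * χ z.2) x| ≤ L := by
  have h1 : HasFDerivAt (fun z : ℝ × ℝ => ξ z.1) (deriv ξ x.1 • ContinuousLinearMap.fst ℝ ℝ ℝ) x :=
    (hξ x.1).hasDerivAt.comp_hasFDerivAt x hasFDerivAt_fst
  have h2 : HasFDerivAt (fun z : ℝ × ℝ => χ z.2) (deriv χ x.2 • ContinuousLinearMap.snd ℝ ℝ ℝ) x :=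
    (hχ x.2).hasDerivAt.comp_hasFDerivAt x hasFDerivAt_snd
  rw [partialDeriv, (h1.fun_mul h2).fderiv]
  fin_cases i
  · simp only [e, add_apply, smul_apply,
      Fin.zero_eta, Matrix.cons_val_zero, ContinuousLinearMap.coe_fst', ContinuousLinearMap.coe_snd',
      smul_eq_mul, mul_one, mul_zero, zero_add, abs_mul]
    exact (mul_le_of_le_one_left (abs_nonneg _) (hχ1 _)).trans (hξL _)
  · simp only [e, add_apply, smul_apply,
      Fin.mk_one, Matrix.cons_val_one, Matrix.cons_val_zero, ContinuousLinearMap.coe_fst', ContinuousLinearMap.coe_snd',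
      smul_eq_mul, mul_one, mul_zero, add_zero, abs_mul]
    exact (mul_le_of_le_one_left (abs_nonneg _) (hξ1 _)).trans (hχL _)

/-! ### Surfaces covered by the coordinate plane -/

section Surface

variable {E : Type*} [NormedAddCommGroup E] [NormedSpace ℝ E]
  {H : Type*} [TopologicalSpace H] {I : ModelWithCorners ℝ E H}
  {M : Type*} [TopologicalSpace M] [ChartedSpace H M]

/-- The tangent map of `p` carries the constant fields `e i` to smooth fields along `p`, and `g` is
smooth as a section of bilinear forms. -/
theorem contDiff_gram [IsManifold I ∞ M] [IsManifold I 1 M] (g : SmoothMetric I M)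
    {p : ℝ × ℝ → M} (hp : ContMDiff 𝓘(ℝ, ℝ × ℝ) I ∞ p) (i j : Fin 2) :
    ContDiff ℝ ∞ fun x => gram g p x i j := by
  have hv (k : Fin 2) : ContMDiff 𝓘(ℝ, ℝ × ℝ) I.tangent ∞ fun x =>
      (⟨p x, mfderiv 𝓘(ℝ, ℝ × ℝ) I p x (e k)⟩ : TangentBundle I M) := by
    have h1 : ContMDiff 𝓘(ℝ, ℝ × ℝ) 𝓘(ℝ, ℝ × ℝ).tangent ∞ fun x : ℝ × ℝ =>
        (⟨x, e k⟩ : TangentBundle 𝓘(ℝ, ℝ × ℝ) (ℝ × ℝ)) := by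
      exact fun x => contMDiffAt_vectorSpace_iff_contDiffAt.2 contDiffAt_const
    exact (hp.contMDiff_tangentMap (m := ∞) le_rfl).comp h1
  have : ContMDiff 𝓘(ℝ, ℝ × ℝ) (I.prod 𝓘(ℝ, ℝ)) ∞ (fun x => Bundle.TotalSpace.mk' ℝ
      (E := Bundle.Trivial M ℝ) (p x) (gram g p x i j)) := by
    refine ContMDiff.clm_bundle_apply₂ (F₁ := E) (F₂ := E) ?_ (hv i) (hv j)
    exact g.contMDiff.comp hp
  exact contMDiff_iff_contDiff.1 fun x => (Bundle.contMDiffAt_totalSpace.1 (this x)).2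

theorem posDef_gram [IsManifold I 1 M] (g : SmoothMetric I M) {p : ℝ × ℝ → M}
    (hp : ∀ x, Function.Injective (mfderiv 𝓘(ℝ, ℝ × ℝ) I p x)) (x : ℝ × ℝ) :
    (gram g p x).PosDef := by
  refine Matrix.PosDef.of_dotProduct_mulVec_pos ?_ fun v hv => ?_
  · ext i j
    simpa [gram] using g.symm _ _ _
  · set w : ℝ × ℝ := v 0 • e 0 + v 1 • e 1 with hw
    have hw0 : w ≠ 0 := by
      intro h
      simp [hw, e] at h
      exact hv (funext fun i => by fin_cases i <;> simp [h])
    have h0 : mfderiv 𝓘(ℝ, ℝ × ℝ) I p x w ≠ 0 := fun h =>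
      hw0 (hp x (h.trans (map_zero _).symm))
    refine (g.pos _ _ h0).trans_eq ?_
    have h1 : mfderiv 𝓘(ℝ, ℝ × ℝ) I p x w = v 0 • mfderiv 𝓘(ℝ, ℝ × ℝ) I p x (e 0)
        + v 1 • mfderiv 𝓘(ℝ, ℝ × ℝ) I p x (e 1) := by
      rw [hw]
      exact (map_add _ _ _).trans (congrArg₂ _ (map_smul _ _ _) (map_smul _ _ _))
    rw [h1]
    simp [gram, dotProduct, Matrix.mulVec, Fin.sum_univ_two]
    ring

/-- Differentiating `p (x + c) = τ (p x)` shows that the coordinate vectors at `x + c` are the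
images under `τ` of those at `x`, and `τ` is an isometry. -/
theorem gram_add [IsManifold I 1 M] (g : SmoothMetric I M) {p : ℝ × ℝ → M}
    (hp : MDifferentiable 𝓘(ℝ, ℝ × ℝ) I p) {τ : M → M} (hτ : MDifferentiable I I τ)
    (hg : Preserves g τ) {c : ℝ × ℝ} (hc : ∀ x, p (x + c) = τ (p x)) :
    Function.Periodic (gram g p) c := by
  intro x
  have h1 : mfderiv 𝓘(ℝ, ℝ × ℝ) I (fun y => p (y + c)) x = mfderiv 𝓘(ℝ, ℝ × ℝ) I p (x + c) := by
    have hadd : HasMFDerivAt 𝓘(ℝ, ℝ × ℝ) 𝓘(ℝ, ℝ × ℝ) (fun y : ℝ × ℝ => y + c) x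
        (ContinuousLinearMap.id ℝ (ℝ × ℝ)) :=
      ((hasFDerivAt_id x).add_const c).hasMFDerivAt
    exact ((hp (x + c)).hasMFDerivAt.comp x hadd).mfderiv
  have h2 : mfderiv 𝓘(ℝ, ℝ × ℝ) I (fun y => p (y + c)) x =
      (mfderiv I I τ (p x)).comp (mfderiv 𝓘(ℝ, ℝ × ℝ) I p x) := by
    rw [show (fun y => p (y + c)) = τ ∘ p from funext hc]
    exact mfderiv_comp x (hτ _) (hp _)
  -- Tangent spaces at `p (x + c)` and `τ (p x)` are distinct types; vectors are compared in the
  -- common model space `E`.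
  have h3 (m m' : M) (hm : m = m') (v w : E) :
      g.inner m (v : TangentSpace I m) (w : TangentSpace I m) =
        g.inner m' (v : TangentSpace I m') (w : TangentSpace I m') := by
    subst hm
    rfl
  have h4 (v : ℝ × ℝ) : (mfderiv 𝓘(ℝ, ℝ × ℝ) I p (x + c) v : E) =
      mfderiv I I τ (p x) (mfderiv 𝓘(ℝ, ℝ × ℝ) I p x v) := by
    have := congrArg (fun A : (ℝ × ℝ) →L[ℝ] E => A v) (h1.symm.trans h2)
    exact this
  ext i j
  refine Eq.trans ?_ (hg (p x) _ _)
  refine (h3 _ _ (hc x) _ _).trans ?_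
  exact congrArg₂ (fun v w : E => g.inner (τ (p x)) (v : TangentSpace I (τ (p x)))
    (w : TangentSpace I (τ (p x)))) (h4 _) (h4 _)

theorem integral_riemMeasure [IsManifold I 1 M] [MeasurableSpace M] (g : SmoothMetric I M)
    {p : ℝ × ℝ → M} {s : M → ℝ × ℝ} (hps : ∀ m, p (s m) = m) (hp : Measurable p)
    (hs : Measurable s) (hr : MeasurableSet (range s)) (hG : IsMetric (gram g p)) (a : ℝ)
    (f : M → ℝ) (hf : ContDiff ℝ 1 fun x => f (p x)) :
    ∫ m, (normSqDiff g p s f m + a * gaussCurvature g p s m * f m ^ 2) ∂(riemMeasure g p s) =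
      ∫ x in range s, energyDensity (gram g p) a (fun x => f (p x)) x := by
  set Φ : ℝ × ℝ → ℝ := fun x => ∑ i, ∑ j, (gram g p x)⁻¹ i j
    * partialDeriv i (fun x => f (p x)) x * partialDeriv j (fun x => f (p x)) x
    + a * coordGaussCurvature (gram g p) x * f (p x) ^ 2 with hΦ
  have hΦc : Continuous Φ :=
    (continuous_finsetSum _ fun i _ => continuous_finsetSum _ fun j _ =>
      ((hG.contDiff_inv i j).continuous.mul (continuous_partialDeriv i hf)).mul
        (continuous_partialDeriv j hf)).add
      ((continuous_const.mul hG.contDiff_curvature.continuous).mul (hf.continuous.pow 2))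
  have h1 (m : M) : normSqDiff g p s f m + a * gaussCurvature g p s m * f m ^ 2 = Φ (s m) := by
    simp only [hΦ, hps]
    rfl
  have hm : Measurable fun m => Φ (s m) := hΦc.measurable.comp hs
  simp only [h1]
  rw [riemMeasure, integral_map hp.aemeasurable hm.aestronglyMeasurable,
    integral_withDensity_eq_integral_toReal_smul
      (hG.contDiff_sqrt_det.continuous.measurable.ennreal_ofReal)
      (Filter.Eventually.of_forall fun x => ENNReal.ofReal_lt_top)]
  refine setIntegral_congr_fun hr ?_
  -- On the range of `s` the map `s ∘ p` is the identity, so the integrand is the coordinate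
  -- expression itself.
  rintro _ ⟨m, rfl⟩
  simp only [hps]
  rw [ENNReal.toReal_ofReal (Real.sqrt_nonneg _), smul_eq_mul, mul_comm]
  rfl

theorem nonnegSet_dichotomy [IsManifold I 1 M] [MeasurableSpace M] (g : SmoothMetric I M)
    {p : ℝ × ℝ → M} {s : M → ℝ × ℝ} (hG : IsMetric (gram g p))
    (h : ∀ a ∈ nonnegSet g p s (gaussCurvature g p s), a ≠ 0 → ∀ m, gaussCurvature g p s m = 0) :
    (nonnegSet g p s (gaussCurvature g p s) = {0} ∨
      nonnegSet g p s (gaussCurvature g p s) = univ) ∧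
    (nonnegSet g p s (gaussCurvature g p s) = univ ↔ ∀ m, gaussCurvature g p s m = 0) := by
  have hn (f : M → ℝ) (m : M) : 0 ≤ normSqDiff g p s f m := hG.normSq_nonneg _ _
  have h0 : (0 : ℝ) ∈ nonnegSet g p s (gaussCurvature g p s) := fun f _ _ =>
    integral_nonneg fun m => by simpa using hn f m
  have hflat (hK : ∀ m, gaussCurvature g p s m = 0) :
      nonnegSet g p s (gaussCurvature g p s) = univ :=
    eq_univ_of_forall fun a f _ _ => integral_nonneg fun m => by simpa [hK] using hn f m
  refine ⟨?_, fun hu => h 1 (hu ▸ mem_univ _) one_ne_zero, hflat⟩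
  by_cases hex : ∃ a ∈ nonnegSet g p s (gaussCurvature g p s), a ≠ 0
  · obtain ⟨a, ha, ha0⟩ := hex
    exact Or.inr (hflat (h a ha ha0))
  · push Not at hex
    exact Or.inl (Subset.antisymm hex (singleton_subset_iff.2 h0))

end Surface

end PeriodicSurface

namespace PeriodicSurface

open MeasureTheory Set

/-! ### Auxiliary facts for the exhaustion by blocks of cells. -/

theorem nonneg_of_forall_nat_mul_add {q D : ℝ} (h : ∀ n : ℕ, 1 ≤ n → 0 ≤ n * q + D) : 0 ≤ q := by
  by_contra! hq
  obtain ⟨n, hn⟩ := exists_nat_gt (D / -q)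
  rw [div_lt_iff₀ (by linarith)] at hn
  have := h (n + 1) (by lia)
  push_cast at this
  linarith

theorem eventuallyEq_one_of_cutoff {ξ χ : ℝ → ℝ} {x : ℝ × ℝ} (hξ : ξ =ᶠ[nhds x.1] 1)
    (hχ : χ =ᶠ[nhds x.2] 1) : (fun z : ℝ × ℝ => ξ z.1 * χ z.2) =ᶠ[nhds x] 1 := by
  filter_upwards [continuousAt_fst.eventually hξ, continuousAt_snd.eventually hχ] with z h1 h2
  simp [h1, h2]

theorem eventuallyEq_one_of_mem_Ioc {χ : ℝ → ℝ} {n : ℕ} (h : ∀ t ∈ Ioo (-1 : ℝ) (n + 1), χ t = 1)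
    {t : ℝ} (ht : t ∈ Ioc (0 : ℝ) n) : χ =ᶠ[nhds t] 1 := by
  filter_upwards [Ioo_mem_nhds (show -1 < t by linarith [ht.1]) (show t < n + 1 by linarith [ht.2])]
    with y hy using h y hy

theorem volume_real_prod (s t : Set ℝ) :
    volume.real (s ×ˢ t) = volume.real s * volume.real t := by
  rw [Measure.volume_eq_prod, measureReal_prod_prod]

/-! ### The plane -/

section Plane

variable (g : SmoothMetric planeModel (ℝ × ℝ))

theorem isMetric_gram_plane : IsMetric (gram g planeParam) where
  contDiff := contDiff_gram g contMDiff_id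
  posDef := posDef_gram g fun x => by
    rw [planeParam, mfderiv_id]
    exact Function.injective_id

theorem doublyPeriodic_gram_plane (hg : ∀ k : ℤ × ℤ, Preserves g (planeShift k)) :
    DoublyPeriodic 1 (gram g planeParam) := by
  have hs (k : ℤ × ℤ) : MDifferentiable planeModel planeModel (planeShift k) := by
    refine Differentiable.mdifferentiable ?_
    unfold planeShift
    fun_prop
  refine ⟨gram_add g mdifferentiable_id (hs (1, 0)) (hg (1, 0)) fun x => ?_,
    gram_add g mdifferentiable_id (hs (0, 1)) (hg (0, 1)) fun x => ?_⟩ <;>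
  simp [planeShift, Prod.ext_iff]

/-- Testing with `u` cut off around an `n × n` block gives `n²` times the cell energy plus an error
of order `n`, the area of the surrounding frame. -/
theorem plane_cell_energy_nonneg (hg : ∀ k : ℤ × ℤ, Preserves g (planeShift k)) {a : ℝ}
    (ha : a ∈ nonnegSet g planeParam planeCoord (gaussCurvature g planeParam planeCoord))
    {u : ℝ × ℝ → ℝ} (hu : ContDiff ℝ 1 u) (hup : DoublyPeriodic 1 u) :
    0 ≤ ∫ z in cell 0 1, energyDensity (gram g planeParam) a u z := by
  have hG := isMetric_gram_plane g
  have hper := doublyPeriodic_gram_plane g hg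
  obtain ⟨L, hL⟩ := exists_cutoff
  obtain ⟨C, hC0, hC⟩ := hG.exists_energyDensity_bound hper one_pos hu hup a L
  -- The frame has area `(n + 4)² - n² = 8n + 16 ≤ 24n` for `n ≥ 1`; one factor `n` is divided out
  -- at the end.
  refine nonneg_of_forall_nat_mul_add (D := C * 24) fun n hn => ?_
  obtain ⟨χ, hχ, hχ1, hχL, hχone, hχzero⟩ := hL n
  have hχd : Differentiable ℝ χ := hχ.differentiable (by simp)
  set ψ : ℝ × ℝ → ℝ := fun z => χ z.1 * χ z.2 with hψdef
  have hψ : ContDiff ℝ 1 ψ :=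
    ((hχ.comp contDiff_fst).mul (hχ.comp contDiff_snd)).of_le (by simp)
  set P : Set (ℝ × ℝ) := Ioc 0 (0 + (n : ℝ) * 1) ×ˢ Ioc 0 (n : ℝ) with hP
  set Q : Set (ℝ × ℝ) := Icc (-2 : ℝ) (n + 2) ×ˢ Icc (-2 : ℝ) (n + 2) with hQ
  have hψQ : ∀ x ∉ Q, ψ x = 0 := by
    intro x hx
    by_cases h1 : x.1 ∈ Icc (-2 : ℝ) (n + 2)
    · have h2 : x.2 ∉ Icc (-2 : ℝ) (n + 2) := fun h2 => hx ⟨h1, h2⟩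
      simp [hψdef, hχzero _ h2]
    · simp [hψdef, hχzero _ h1]
  have hψP : ∀ x ∈ P, ψ =ᶠ[nhds x] 1 := by
    rintro x ⟨h1, h2⟩
    simp only [zero_add, mul_one] at h1
    exact eventuallyEq_one_of_cutoff (eventuallyEq_one_of_mem_Ioc hχone h1)
      (eventuallyEq_one_of_mem_Ioc hχone h2)
  have hQc : IsCompact Q := isCompact_Icc.prod isCompact_Icc
  have hle := setIntegral_energyDensity_le (a := a) (S := univ) (P := P) (Q := Q) hG hu hψ
    (hC ψ hψ (fun x => by
      rw [hψdef, abs_mul]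
      exact mul_le_one₀ (hχ1 _) (abs_nonneg _) (hχ1 _))
      (abs_partialDeriv_prod_le hχd hχd hχ1 hχ1 hχL hχL))
    MeasurableSet.univ (measurableSet_Ioc.prod measurableSet_Ioc) hQc.isClosed
    (by
      rw [univ_inter]
      refine prod_mono (fun t ht => ?_) fun t ht => ?_
      · simp only [zero_add, mul_one] at ht
        exact ⟨by linarith [ht.1], by linarith [ht.2]⟩
      · exact ⟨by linarith [ht.1], by linarith [ht.2]⟩)
    (by
      rw [univ_inter]
      exact hQc.measure_lt_top.ne)
    hψP hψQ
  have hf := ha (fun y => u y * ψ y) (hu.mul hψ).contMDiff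
    (HasCompactSupport.intro hQc fun x hx => by simp [hψQ x hx])
  have hr : range planeCoord = univ := range_id
  rw [integral_riemMeasure g (p := planeParam) (s := planeCoord) (fun m => rfl) measurable_id
    measurable_id (hr ▸ MeasurableSet.univ) hG a _ (hu.mul hψ), hr] at hf
  have hle' := hf.trans hle
  rw [setIntegral_cells one_pos 0 (hper.energyDensity hup) (hG.continuous_energyDensity hu),
    univ_inter, hP, hQ, volume_real_prod, volume_real_prod] at hle'
  have hn0 : (0 : ℝ) ≤ n := by positivity
  have hn1 : (1 : ℝ) ≤ n := by exact_mod_cast hn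
  rw [Real.volume_real_Ioc_of_le (by linarith), Real.volume_real_Ioc_of_le hn0,
    Real.volume_real_Icc_of_le (by linarith)] at hle'
  refine nonneg_of_mul_nonneg_right (a := (n : ℝ)) ?_ (by linarith)
  nlinarith [mul_nonneg hC0 (sub_nonneg.2 hn1)]

theorem plane_curvature_eq_zero (hg : ∀ k : ℤ × ℤ, Preserves g (planeShift k)) {a : ℝ}
    (ha : a ∈ nonnegSet g planeParam planeCoord (gaussCurvature g planeParam planeCoord))
    (ha0 : a ≠ 0) (m : ℝ × ℝ) : gaussCurvature g planeParam planeCoord m = 0 := by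
  have hG := isMetric_gram_plane g
  have hper := doublyPeriodic_gram_plane g hg
  refine hG.curvature_eq_zero hper one_pos 0 ha0 (fun t => ?_) _
  exact plane_cell_energy_nonneg g hg ha
    ((contDiff_const.add (contDiff_const.mul hG.contDiff_curvature)).of_le (by simp))
    (hper.curvature.comp fun k => 1 + t * k)

end Plane

/-! ### The cylinder -/

section Cylinder

theorem contMDiff_coe_circle : ContMDiff (𝓡 1) 𝓘(ℝ, ℂ) ∞ (fun z : Circle => (z : ℂ)) :=
  haveI := finrank_real_complex_fact'
  contMDiff_coe_sphere (E := ℂ) (n := 1)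

theorem contMDiff_cylParam : ContMDiff 𝓘(ℝ, ℝ × ℝ) cylModel ∞ cylParam :=
  (contMDiff_circleExp.comp contDiff_fst.contMDiff).prodMk contDiff_snd.contMDiff

theorem injective_mfderiv_cylParam (x : ℝ × ℝ) :
    Function.Injective (mfderiv 𝓘(ℝ, ℝ × ℝ) cylModel cylParam x) := by
  -- After composition with the inclusion into `ℂ × ℝ` the differential is explicit and visibly
  -- injective.
  set q : Circle × ℝ → ℂ × ℝ := fun m => ((m.1 : ℂ), m.2) with hq
  have hqs : ContMDiff cylModel 𝓘(ℝ, ℂ × ℝ) ∞ q :=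
    (contMDiff_coe_circle.comp contMDiff_fst).prodMk_space contMDiff_snd
  have h1 : HasFDerivAt (q ∘ cylParam) ((((ContinuousLinearMap.fst ℝ ℝ ℝ).smulRight
      (Complex.exp (x.1 * Complex.I) * Complex.I))).prod (ContinuousLinearMap.snd ℝ ℝ ℝ)) x := by
    refine HasFDerivAt.prodMk ?_ hasFDerivAt_snd
    have h2 : HasDerivAt (fun t : ℝ => Complex.exp (t * Complex.I))
        (Complex.exp (x.1 * Complex.I) * Complex.I) x.1 := by
      have := ((hasDerivAt_id (x.1 : ℂ)).mul_const Complex.I).cexp.comp_ofReal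
      simpa using this
    have := h2.hasFDerivAt.comp x (hasFDerivAt_fst (p := x))
    refine this.congr_fderiv ?_
    ext <;> simp
  have h2 := mfderiv_comp x (hqs.mdifferentiable (by simp) (cylParam x))
    (contMDiff_cylParam.mdifferentiable (by simp) x)
  rw [h1.hasMFDerivAt.mfderiv] at h2
  intro v w hvw
  have h3 : ∀ v : ℝ × ℝ, _ := fun v : ℝ × ℝ =>
    congrArg (fun A : (ℝ × ℝ) →L[ℝ] ℂ × ℝ => A v) h2
  have h4 := (h3 v).trans ((congrArg (mfderiv cylModel 𝓘(ℝ, ℂ × ℝ) q (cylParam x)) hvw).trans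
    (h3 w).symm)
  obtain ⟨h5, h6⟩ := Prod.ext_iff.1 h4
  have h5' : v.1 • (Complex.exp (x.1 * Complex.I) * Complex.I) =
      w.1 • (Complex.exp (x.1 * Complex.I) * Complex.I) := h5
  exact Prod.ext (smul_left_injective ℝ (by simp [Complex.exp_ne_zero]) h5') h6

variable (g : SmoothMetric cylModel (Circle × ℝ))

theorem isMetric_gram_cyl : IsMetric (gram g cylParam) where
  contDiff := contDiff_gram g contMDiff_cylParam
  posDef := posDef_gram g injective_mfderiv_cylParam

theorem doublyPeriodic_gram_cyl (hg : ∀ k : ℤ, Preserves g (cylShift k)) :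
    DoublyPeriodic (2 * Real.pi) (gram g cylParam) := by
  have hp : MDifferentiable 𝓘(ℝ, ℝ × ℝ) cylModel cylParam :=
    contMDiff_cylParam.mdifferentiable (by simp)
  have hs (k : ℤ) : MDifferentiable cylModel cylModel (cylShift k) := by
    have : ContMDiff cylModel cylModel ∞ (cylShift k) :=
      contMDiff_fst.prodMk (contMDiff_snd.add contMDiff_const)
    exact this.mdifferentiable (by simp)
  -- The period `2π` is a deck translation of the covering, so it lies over the identity; the period
  -- 1 lies over `cylShift 1`.
  refine ⟨gram_add g hp mdifferentiable_id (fun m v w => ?_) fun x => ?_,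
    gram_add g hp (hs 1) (hg 1) fun x => ?_⟩
  · rw [mfderiv_id]
    rfl
  · simp [cylParam, Circle.exp_add]
  · simp [cylParam, cylShift]

theorem measurable_cylParam : Measurable cylParam :=
  (Circle.exp.continuous.measurable.comp measurable_fst).prodMk measurable_snd

theorem measurable_cylCoord : Measurable cylCoord := by
  have h : Continuous fun z : Circle => (z : ℂ) := continuous_subtype_val
  exact (Complex.measurable_arg.comp (h.measurable.comp measurable_fst)).prodMk measurable_snd

theorem contMDiffAt_arg_circle {z : Circle} (hz : (z : ℂ) ∈ Complex.slitPlane) :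
    ContMDiffAt (𝓡 1) 𝓘(ℝ, ℝ) ∞ (fun w : Circle => Complex.arg w) z := by
  have h1 : ContDiffAt ℝ ∞ Complex.arg (z : ℂ) := by
    have h2 : ContDiffAt ℝ ∞ (fun w : ℂ => (Complex.log w).im) z :=
      Complex.imCLM.contDiff.contDiffAt.comp _ ((Complex.contDiffAt_log hz).restrict_scalars ℝ)
    simpa only [Complex.log_im] using h2
  exact h1.contMDiffAt.comp z contMDiff_coe_circle.contMDiffAt

/-- A smooth function on the plane which is `2π`-periodic in the first variable descends to a
smooth function on the cylinder. -/
theorem exists_descend {F : ℝ × ℝ → ℝ} (hF : ContDiff ℝ 1 F)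
    (hper : Function.Periodic F (2 * Real.pi, 0)) :
    ∃ f : Circle × ℝ → ℝ, ContMDiff cylModel 𝓘(ℝ, ℝ) 1 f ∧ ∀ x, f (cylParam x) = F x := by
  have hdesc (x y : ℝ × ℝ) (hxy : cylParam x = cylParam y) : F x = F y := by
    obtain ⟨h1, h2⟩ := Prod.ext_iff.1 hxy
    obtain ⟨n, hn⟩ := Circle.exp_eq_exp.1 h1
    have : x = y + n • ((2 * Real.pi, 0) : ℝ × ℝ) := by
      ext
      · simp [hn]
      · simpa [cylParam] using h2
    rw [this]
    exact hper.zsmul n y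
  refine ⟨fun m => F (cylCoord m), fun m => ?_, fun x => hdesc _ _ (cylParam_cylCoord _)⟩
  by_cases hm : (m.1 : ℂ) ∈ Complex.slitPlane
  · refine hF.contDiffAt.contMDiffAt.comp m (ContMDiffAt.prodMk_space ?_ contMDiffAt_snd)
    exact ((contMDiffAt_arg_circle hm).comp m contMDiffAt_fst).of_le (by simp)
  -- On the circle the branch cut of the argument is the point `-1`. There the angle is computed
  -- after rotating by `π`; it may change by a multiple of `2π`, which `F` does not see.
  · have hm' : ((Circle.exp Real.pi * m.1 : Circle) : ℂ) ∈ Complex.slitPlane := by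
      rw [Complex.mem_slitPlane_iff] at hm ⊢
      push Not at hm
      have h0 : (m.1 : ℂ).re ≠ 0 := fun h => Circle.coe_ne_zero m.1 (Complex.ext h hm.2)
      left
      simpa using lt_of_le_of_ne hm.1 h0
    have heq : (fun m => F (cylCoord m)) = fun m : Circle × ℝ =>
        F (Complex.arg ((Circle.exp Real.pi * m.1 : Circle) : ℂ) - Real.pi, m.2) := by
      ext m
      refine hdesc _ _ ?_
      rw [cylParam_cylCoord]
      simp only [cylParam, Circle.exp_sub, Circle.exp_arg, mul_div_cancel_left]
    rw [heq]
    refine hF.contDiffAt.contMDiffAt.comp m (ContMDiffAt.prodMk_space ?_ contMDiffAt_snd)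
    have h1 : ContMDiffAt cylModel (𝓡 1) ∞ (fun m : Circle × ℝ => Circle.exp Real.pi * m.1) m :=
      (contMDiff_mul_left (a := Circle.exp Real.pi)).contMDiffAt.comp m contMDiffAt_fst
    have h2 : ContMDiffAt cylModel 𝓘(ℝ, ℝ) ∞ (fun m : Circle × ℝ =>
        Complex.arg ((Circle.exp Real.pi * m.1 : Circle) : ℂ) - Real.pi) m :=
      ((contMDiffAt_arg_circle hm').comp m h1).sub contMDiffAt_const
    exact h2.of_le (by simp)

/-- The circle direction is compact, so cutting off is needed only along the axis, and the error
stays bounded while the number of cells grows. -/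
theorem cyl_cell_energy_nonneg (hg : ∀ k : ℤ, Preserves g (cylShift k)) {a : ℝ}
    (ha : a ∈ nonnegSet g cylParam cylCoord (gaussCurvature g cylParam cylCoord))
    {u : ℝ × ℝ → ℝ} (hu : ContDiff ℝ 1 u) (hup : DoublyPeriodic (2 * Real.pi) u) :
    0 ≤ ∫ z in cell (-Real.pi) (2 * Real.pi), energyDensity (gram g cylParam) a u z := by
  have hG := isMetric_gram_cyl g
  have hper := doublyPeriodic_gram_cyl g hg
  have hpi := Real.pi_pos
  obtain ⟨L, hL⟩ := exists_cutoff
  obtain ⟨C, hC0, hC⟩ := hG.exists_energyDensity_bound hper Real.two_pi_pos hu hup a L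
  -- The excess area is `2π((n + 4) - n) = 8π`.
  refine nonneg_of_forall_nat_mul_add (D := C * (8 * Real.pi)) fun n hn => ?_
  obtain ⟨χ, hχ, hχ1, hχL, hχone, hχzero⟩ := hL n
  have hχd : Differentiable ℝ χ := hχ.differentiable (by simp)
  set ψ : ℝ × ℝ → ℝ := fun z => 1 * χ z.2 with hψdef
  have hψ : ContDiff ℝ 1 ψ := (contDiff_const.mul (hχ.comp contDiff_snd)).of_le (by simp)
  set P : Set (ℝ × ℝ) := Ioc (-Real.pi) (-Real.pi + (1 : ℕ) * (2 * Real.pi)) ×ˢ Ioc 0 (n : ℝ)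
    with hP
  set Q : Set (ℝ × ℝ) := univ ×ˢ Icc (-2 : ℝ) (n + 2) with hQ
  have hψQ : ∀ x ∉ Q, ψ x = 0 := by
    intro x hx
    have h2 : x.2 ∉ Icc (-2 : ℝ) (n + 2) := fun h2 => hx ⟨trivial, h2⟩
    simp [hψdef, hχzero _ h2]
  have hψP : ∀ x ∈ P, ψ =ᶠ[nhds x] 1 := by
    rintro x ⟨-, h2⟩
    exact eventuallyEq_one_of_cutoff (ξ := fun _ => 1) (Filter.EventuallyEq.rfl)
      (eventuallyEq_one_of_mem_Ioc hχone h2)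
  have hend : -Real.pi + (1 : ℕ) * (2 * Real.pi) = Real.pi := by
    push_cast
    ring
  have hSQ : range cylCoord ∩ Q = Ioc (-Real.pi) Real.pi ×ˢ Icc (-2 : ℝ) (n + 2) := by
    rw [range_cylCoord, hQ, prod_inter_prod, inter_univ, univ_inter]
  have hr : MeasurableSet (range cylCoord) := by
    rw [range_cylCoord]
    exact measurableSet_Ioc.prod MeasurableSet.univ
  have hle := setIntegral_energyDensity_le (a := a) (S := range cylCoord) (P := P) (Q := Q)
    hG hu hψ
    (hC ψ hψ (fun x => by simpa [hψdef] using hχ1 x.2)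
      (abs_partialDeriv_prod_le (differentiable_const 1) hχd (fun t => by simp) hχ1
        (fun t => by simpa using (abs_nonneg _).trans (hχL 0)) hχL))
    hr (measurableSet_Ioc.prod measurableSet_Ioc) (isClosed_univ.prod isClosed_Icc)
    (by
      rw [hSQ, hP, hend]
      exact prod_mono le_rfl fun t ht => ⟨by linarith [ht.1], by linarith [ht.2]⟩)
    (by
      rw [hSQ]
      exact ((measure_mono (prod_mono Ioc_subset_Icc_self le_rfl)).trans_lt
        (isCompact_Icc.prod isCompact_Icc).measure_lt_top).ne)
    hψP hψQ
  -- The cut-off depends on the axial variable only, so the product keeps its period `2π` and is the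
  -- lift of a function on the cylinder.
  obtain ⟨f, hfs, hfF⟩ := exists_descend (hu.mul hψ) fun x => by
    simp [hψdef, hup.fst x]
  have hf := ha f hfs (HasCompactSupport.intro
    (isCompact_univ.prod (isCompact_Icc (a := (-2 : ℝ)) (b := n + 2))) fun m hm => by
      rw [← cylParam_cylCoord m, hfF]
      have : ψ (cylCoord m) = 0 := hψQ _ fun h => hm ⟨trivial, h.2⟩
      simp [this])
  have hfF' : (fun x => f (cylParam x)) = fun x => u x * ψ x := funext hfF
  rw [integral_riemMeasure g cylParam_cylCoord measurable_cylParam measurable_cylCoord hr hG a f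
    (hfF' ▸ hu.mul hψ), hfF'] at hf
  have hle' := hf.trans hle
  rw [setIntegral_cells Real.two_pi_pos _ (hper.energyDensity hup)
    (hG.continuous_energyDensity hu), hSQ, hP, hend,
    volume_real_prod, volume_real_prod] at hle'
  have hn0 : (0 : ℝ) ≤ n := by positivity
  rw [Real.volume_real_Ioc_of_le (by linarith), Real.volume_real_Ioc_of_le hn0,
    Real.volume_real_Icc_of_le (by linarith)] at hle'
  refine hle'.trans_eq ?_
  push_cast
  ring

theorem cyl_curvature_eq_zero (hg : ∀ k : ℤ, Preserves g (cylShift k)) {a : ℝ}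
    (ha : a ∈ nonnegSet g cylParam cylCoord (gaussCurvature g cylParam cylCoord))
    (ha0 : a ≠ 0) (m : Circle × ℝ) : gaussCurvature g cylParam cylCoord m = 0 := by
  have hG := isMetric_gram_cyl g
  have hper := doublyPeriodic_gram_cyl g hg
  refine hG.curvature_eq_zero hper Real.two_pi_pos (-Real.pi) ha0 (fun t => ?_) _
  exact cyl_cell_energy_nonneg g hg ha
    ((contDiff_const.add (contDiff_const.mul hG.contDiff_curvature)).of_le (by simp))
    (hper.curvature.comp fun k => 1 + t * k)

end Cylinder

end PeriodicSurface

open PeriodicSurface in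
theorem corollary2 :
    (∀ g : SmoothMetric planeModel (ℝ × ℝ), (∀ k : ℤ × ℤ, Preserves g (planeShift k)) →
      (nonnegSet g planeParam planeCoord (gaussCurvature g planeParam planeCoord) = {0} ∨
        nonnegSet g planeParam planeCoord (gaussCurvature g planeParam planeCoord) = Set.univ) ∧
      (nonnegSet g planeParam planeCoord (gaussCurvature g planeParam planeCoord) = Set.univ ↔
        ∀ m, gaussCurvature g planeParam planeCoord m = 0)) ∧
    (∀ g : SmoothMetric cylModel (Circle × ℝ), (∀ k : ℤ, Preserves g (cylShift k)) →
      (nonnegSet g cylParam cylCoord (gaussCurvature g cylParam cylCoord) = {0} ∨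
        nonnegSet g cylParam cylCoord (gaussCurvature g cylParam cylCoord) = Set.univ) ∧
      (nonnegSet g cylParam cylCoord (gaussCurvature g cylParam cylCoord) = Set.univ ↔
        ∀ m, gaussCurvature g cylParam cylCoord m = 0)) := by
  exact ⟨fun g hg => nonnegSet_dichotomy g (isMetric_gram_plane g)
      fun a ha ha0 => plane_curvature_eq_zero g hg ha ha0,
    fun g hg => nonnegSet_dichotomy g (isMetric_gram_cyl g)
      fun a ha ha0 => cyl_curvature_eq_zero g hg ha ha0⟩
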